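/- Let $q$ be a prime power. Represent a point $P=(y_0,\dots,y_5)$ of $\mathrm{PG}(5,q)$ by the symmetric matrix $$M_P=\begin{bmatrix} y_0&y_1&y_2\\ y_1&y_3&y_4\\ y_2&y_4&y_5\end{bmatrix},$$ and call the rank of $M_P$ the rank of $P$. Let $\mathcal V(\mathbb F_q)\subset \mathrm{PG}(5,q)$ be the Veronese surface, the image of $(u_0,u_1,u_2)\mapsto(u_0^2,u_0u_1,u_0u_2,u_1^2,u_1u_2,u_2^2)$. Its secant variety is the set of points of $\mathrm{PG}(5,q)$ in the Zariski closure of the union of the lines joining two distinct points of the Veronese surface over the algebraic closure $\overline{\mathbb F}_q$. A hyperplane of $\mathrm{PG}(5,q)$ is of type $\mathcal H_3$ if it has an equation $a_{00}Y_0+a_{01}Y_1+a_{02}Y_2+a_{11}Y_3+a_{12}Y_4+a_{22}Y_5=0$ for which the conic $\sum_{0\le i\le j\le 2}a_{ij}X_iX_j=0$ of $\mathrm{PG}(2,q)$ is non-singular, that is, $$4a_{00}a_{11}a_{22}+a_{01}a_{02}a_{12}-a_{00}a_{12}^2-a_{11}a_{02}^2-a_{22}a_{01}^2\neq 0.$$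 Then every point of the secant variety of $\mathcal V(\mathbb F_q)$ lies in exactly $q^4-q^2$ hyperplanes of type $\mathcal H_3$; likewise, every point of $\mathrm{PG}(5,q)$ of rank at most $2$ lies in exactly $q^4-q^2$ hyperplanes of type $\mathcal H_3$. -/

import Mathlib

open scoped LinearAlgebra.Projectivization

namespace ConicSystems

/-- The Veronese map `(u₀,u₁,u₂) ↦ (u₀², u₀u₁, u₀u₂, u₁², u₁u₂, u₂²)` on coordinate vectors. -/
def veronese {F : Type*} [Field F] (u : Fin 3 → F) : Fin 6 → F :=
  ![u 0 ^ 2, u 0 * u 1, u 0 * u 2, u 1 ^ 2, u 1 * u 2, u 2 ^ 2]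

/-- The symmetric `3 × 3` matrix attached to a coordinate vector `(y₀,…,y₅)`. -/
def symMatrix {F : Type*} [Field F] (y : Fin 6 → F) : Matrix (Fin 3) (Fin 3) F :=
  !![y 0, y 1, y 2; y 1, y 3, y 4; y 2, y 4, y 5]

/-- The rank of a point `P` of `PG(5,q)`: the rank of its symmetric matrix. It does not depend on
the chosen coordinate vector, since these differ by nonzero scalars. -/
noncomputable def pointRank {K : Type*} [Field K] (P : ℙ K (Fin 6 → K)) : ℕ :=
  (symMatrix P.rep).rank

/-- The `K`-rational points of the secant variety of the Veronese surface: the points of `PG(5,K)`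
in the Zariski closure of the union of all lines joining two distinct points of the Veronese
surface over the algebraic closure of `K`, i.e. the points at which every form vanishes that
vanishes on all these secant lines. -/
def secantVariety (K : Type*) [Field K] : Set (ℙ K (Fin 6 → K)) :=
  {P | ∀ (d : ℕ) (g : MvPolynomial (Fin 6) (AlgebraicClosure K)), g.IsHomogeneous d →
    (∀ u v : Fin 3 → AlgebraicClosure K, LinearIndependent (AlgebraicClosure K) ![u, v] →
      ∀ s t : AlgebraicClosure K, MvPolynomial.eval (s • veronese u + t • veronese v) g = 0) →
    MvPolynomial.eval (fun i => algebraMap K (AlgebraicClosure K) (P.rep i)) g = 0}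

/-- The coefficient `a_{ij}` of `X_i X_j` in a polynomial in `X_0, X_1, X_2`. -/
noncomputable def quadCoeff {K : Type*} [Field K] (f : MvPolynomial (Fin 3) K)
    (i j : Fin 3) : K :=
  f.coeff (Finsupp.single i 1 + Finsupp.single j 1)

/-- The discriminant of the quadratic form `f = ∑_{i ≤ j} a_{ij} X_i X_j`. -/
noncomputable def discriminant {K : Type*} [Field K] (f : MvPolynomial (Fin 3) K) : K :=
  4 * quadCoeff f 0 0 * quadCoeff f 1 1 * quadCoeff f 2 2
    + quadCoeff f 0 1 * quadCoeff f 0 2 * quadCoeff f 1 2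
    - quadCoeff f 0 0 * quadCoeff f 1 2 ^ 2
    - quadCoeff f 1 1 * quadCoeff f 0 2 ^ 2
    - quadCoeff f 2 2 * quadCoeff f 0 1 ^ 2

/-- The subspace `a₀₀Y₀ + a₀₁Y₁ + a₀₂Y₂ + a₁₁Y₃ + a₁₂Y₄ + a₂₂Y₅ = 0` of `K⁶` attached to the
quadratic form `f = ∑_{i ≤ j} a_{ij} X_i X_j`; for `f ≠ 0` it is a hyperplane of `PG(5,K)`. -/
noncomputable def conicHyperplane {K : Type*} [Field K] (f : MvPolynomial (Fin 3) K) :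
    Submodule K (Fin 6 → K) :=
  LinearMap.ker (Fintype.linearCombination K
    ![quadCoeff f 0 0, quadCoeff f 0 1, quadCoeff f 0 2,
      quadCoeff f 1 1, quadCoeff f 1 2, quadCoeff f 2 2])

theorem mem_conicHyperplane {K : Type*} [Field K] (f : MvPolynomial (Fin 3) K)
    (y : Fin 6 → K) :
    y ∈ conicHyperplane f ↔
      quadCoeff f 0 0 * y 0 + quadCoeff f 0 1 * y 1 + quadCoeff f 0 2 * y 2
        + quadCoeff f 1 1 * y 3 + quadCoeff f 1 2 * y 4 + quadCoeff f 2 2 * y 5 = 0 := by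
  simp [conicHyperplane, Fintype.linearCombination_apply, Fin.sum_univ_succ, mul_comm, add_assoc]

/-- The hyperplanes of type `H₃`: those corresponding to non-singular conics. Hyperplanes of
`PG(5,K)` are the coatoms (maximal proper subspaces) of `K⁶`. -/
def typeH3 (K : Type*) [Field K] : Set (Submodule K (Fin 6 → K)) :=
  {H | IsCoatom H ∧ ∃ f : MvPolynomial (Fin 3) K,
    f.IsHomogeneous 2 ∧ discriminant f ≠ 0 ∧ H = conicHyperplane f}

end ConicSystems

/-! Both hypotheses give `det M_P = 0`, and that alone yields the count. Take a kernel vector of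
`M_P`, scaled after a permutation of the variables to `(u, v, 1)`. The unimodular substitution `X₂ ↦
X₂ - uX₀ - vX₁` preserves the discriminant and turns incidence with `P` into one nontrivial linear
condition on the binary part `(a₀₀, a₀₁, a₁₁)`. It has `q² - 1` nonzero solutions, each with `q³ -
q²` nonsingular completions (`natCard_pairs`). Proportional forms define the same hyperplane, so
dividing by `q - 1` leaves `q⁴ - q²`. -/

namespace ConicSystems

/-! ### Counting ternary forms over a fixed binary part. -/

section Counting

variable {K : Type*} [Field K]

theorem natCard_graph {α β : Type*} (p : α × β → Prop) (h : β → α)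
    (hp : ∀ x, p x ↔ x.1 = h x.2) : Nat.card {x // p x} = Nat.card β :=
  Nat.card_congr
    { toFun := fun x => x.1.2
      invFun := fun b => ⟨(h b, b), (hp _).2 rfl⟩
      left_inv := fun x => Subtype.ext (Prod.ext ((hp _).1 x.2).symm rfl)
      right_inv := fun _ => rfl }

/-- The linear equation `x a + y b + z c = 0` has `q²` solutions if `(x, y, z) ≠ 0`. -/
theorem natCard_linear_zeros [Finite K] (x y z : K) (h : ¬(x = 0 ∧ y = 0 ∧ z = 0)) :
    Nat.card {v : K × K × K // x * v.1 + y * v.2.1 + z * v.2.2 = 0} = Nat.card K ^ 2 := by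
  have hK : Nat.card (K × K) = Nat.card K ^ 2 := by rw [Nat.card_prod, sq]
  by_cases hx : x = 0
  · by_cases hy : y = 0
    · have hz : z ≠ 0 := fun hz => h ⟨hx, hy, hz⟩
      rw [← hK, ← natCard_graph (fun v : K × (K × K) => z * v.1 = 0) (fun _ => 0)
        (by intro v; simp [hz])]
      refine Nat.card_congr (Equiv.subtypeEquiv
        ⟨fun v => (v.2.2, v.1, v.2.1), fun v => (v.2.1, v.2.2, v.1), fun _ => rfl, fun _ => rfl⟩ ?_)
      intro v
      simp [hx, hy]
    · rw [← hK, ← natCard_graph (fun v : K × (K × K) => x * v.2.1 + y * v.1 + z * v.2.2 = 0)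
        (fun v => -(x * v.1 + z * v.2) / y)
        (by
          intro v
          rw [eq_div_iff hy]
          constructor <;> intro e <;> linear_combination e)]
      refine Nat.card_congr (Equiv.subtypeEquiv
        ⟨fun v => (v.2.1, v.1, v.2.2), fun v => (v.2.1, v.1, v.2.2), fun _ => rfl, fun _ => rfl⟩ ?_)
      intro v
      rfl
  · rw [← hK, natCard_graph _ (fun v => -(y * v.1 + z * v.2) / x)]
    intro v
    rw [eq_div_iff hx]
    constructor <;> intro e <;> linear_combination e

/-- Over a finite field a binary quadratic form of discriminant zero with nonzero leading
coefficient is a multiple of the square of a linear form. -/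
theorem exists_square_factor [Finite K] {a b c : K} (ha : a ≠ 0) (h : 4 * a * c = b ^ 2) :
    ∃ s, b = 2 * a * s ∧ c = a * s ^ 2 := by
  by_cases h2 : (2 : K) = 0
  · have hchar : ringChar K = 2 := by
      have : Fact (ringChar K).Prime := ⟨CharP.char_is_prime K _⟩
      have := (ringChar.spec K 2).1 (by exact_mod_cast h2)
      exact (Nat.prime_dvd_prime_iff_eq (CharP.char_is_prime K _) Nat.prime_two).1 this
    -- In characteristic 2 the hypothesis forces `b = 0`, and every element of a finite field is a
    -- square.
    obtain ⟨s, hs⟩ := FiniteField.isSquare_of_char_two hchar (c / a)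
    have hb : b = 0 := by
      have : b ^ 2 = 0 := by linear_combination -h + 2 * a * c * h2
      simpa using this
    refine ⟨s, by rw [hb, h2]; ring, ?_⟩
    rw [div_eq_iff ha] at hs
    rw [hs]; ring
  · refine ⟨b / (2 * a), by field_simp, ?_⟩
    field_simp
    linear_combination h

/-- The discriminant of a ternary quadratic form, its coefficients being grouped as
`((a₀₀, a₀₁, a₁₁), (a₀₂, a₁₂, a₂₂))`. -/
def pairDisc (v w : K × K × K) : K :=
  4 * v.1 * v.2.2 * w.2.2 + v.2.1 * w.1 * w.2.1 - v.1 * w.2.1 ^ 2 - v.2.2 * w.1 ^ 2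
    - w.2.2 * v.2.1 ^ 2

/-- The discriminant is affine in `a₂₂` with leading coefficient `4ac - b²`. If this is nonzero,
`a₂₂` is determined by the other two entries. Otherwise the binary form is a multiple of a square
and the discriminant is a nonzero multiple of the square of a linear form in `(a₀₂, a₁₂)`. Either
way the zero set is a graph over `K × K`. -/
theorem natCard_pairDisc_zeros [Finite K] (v : K × K × K) (hv : v ≠ 0) :
    Nat.card {w : K × K × K // pairDisc v w = 0} = Nat.card K ^ 2 := by
  have hK : Nat.card (K × K) = Nat.card K ^ 2 := by rw [Nat.card_prod, sq]
  obtain ⟨a, b, c⟩ := v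
  have hperm : ∀ (e : K × K × K ≃ K × (K × K)) (h : K × K → K),
      (∀ w, pairDisc (a, b, c) w = 0 ↔ (e w).1 = h (e w).2) →
      Nat.card {w : K × K × K // pairDisc (a, b, c) w = 0} = Nat.card K ^ 2 := by
    intro e h he
    rw [← hK, ← natCard_graph (fun x : K × (K × K) => x.1 = h x.2) h (fun _ => Iff.rfl)]
    exact Nat.card_congr (Equiv.subtypeEquiv e he)
  by_cases hD : 4 * a * c - b ^ 2 = 0
  · by_cases ha : a = 0
    · have hb : b = 0 := by
        have : b ^ 2 = 0 := by linear_combination 4 * c * ha - hD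
        simpa using this
      have hc : c ≠ 0 := by
        rintro rfl
        exact hv (by simp [ha, hb])
      refine hperm (Equiv.refl _) (fun _ => 0) fun w => ?_
      simp [pairDisc, ha, hb, hc]
    · obtain ⟨s, hb, hc⟩ := exists_square_factor ha (sub_eq_zero.1 hD)
      refine hperm
        ⟨fun w => (w.2.1, w.1, w.2.2), fun w => (w.2.1, w.1, w.2.2), fun _ => rfl, fun _ => rfl⟩
        (fun w => s * w.1) fun w => ?_
      have : pairDisc (a, b, c) w = -a * (w.2.1 - s * w.1) ^ 2 := by
        simp only [pairDisc]
        rw [hb, hc]; ring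
      rw [this]
      simp [ha, sub_eq_zero]
  · refine hperm
      ⟨fun w => (w.2.2, w.1, w.2.1), fun w => (w.2.1, w.2.2, w.1), fun _ => rfl, fun _ => rfl⟩
      (fun w => (a * w.2 ^ 2 + c * w.1 ^ 2 - b * w.1 * w.2) / (4 * a * c - b ^ 2)) fun w => ?_
    simp only [pairDisc, Equiv.coe_fn_mk]
    rw [eq_div_iff hD]
    constructor <;> intro e <;> linear_combination e

theorem natCard_pairDisc_ne_zero [Finite K] (v : K × K × K) (hv : v ≠ 0) :
    (Nat.card {w : K × K × K // pairDisc v w ≠ 0} : ℤ) = Nat.card K ^ 3 - Nat.card K ^ 2 := by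
  classical
  have h := Nat.card_congr (Equiv.sumCompl (fun w : K × K × K => pairDisc v w = 0))
  rw [Nat.card_sum, natCard_pairDisc_zeros v hv, Nat.card_prod, Nat.card_prod] at h
  have h' := congrArg (Nat.cast : ℕ → ℤ) h
  push_cast at h'
  simp only [ne_eq]
  linear_combination h'

theorem natCard_pairs [Finite K] (x y z : K) (h : ¬(x = 0 ∧ y = 0 ∧ z = 0)) :
    (Nat.card {p : (K × K × K) × (K × K × K) //
        pairDisc p.1 p.2 ≠ 0 ∧ x * p.1.1 + y * p.1.2.1 + z * p.1.2.2 = 0} : ℤ)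
      = ((Nat.card K : ℤ) ^ 2 - 1) * (Nat.card K ^ 3 - Nat.card K ^ 2) := by
  classical
  have := Fintype.ofFinite K
  let e : {p : (K × K × K) × (K × K × K) //
        pairDisc p.1 p.2 ≠ 0 ∧ x * p.1.1 + y * p.1.2.1 + z * p.1.2.2 = 0} ≃
      Σ v : {v : K × K × K // x * v.1 + y * v.2.1 + z * v.2.2 = 0},
        {w : K × K × K // pairDisc v.1 w ≠ 0} :=
    { toFun := fun p => ⟨⟨p.1.1, p.2.2⟩, ⟨p.1.2, p.2.1⟩⟩
      invFun := fun s => ⟨(s.1.1, s.2.1), s.2.2, s.1.2⟩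
      left_inv := fun _ => rfl
      right_inv := fun _ => rfl }
  have hzero : Nat.card {w : K × K × K // pairDisc 0 w ≠ 0} = 0 := by
    simp [pairDisc]
  have hlin := natCard_linear_zeros x y z h
  rw [Nat.card_congr e, Nat.card_sigma]
  push_cast
  -- The zero binary part has no nonsingular completion, so it is split off.
  rw [← Finset.add_sum_erase _ _ (Finset.mem_univ ⟨0, by simp⟩)]
  rw [Finset.sum_congr rfl (g := fun _ => ((Nat.card K : ℤ) ^ 3 - Nat.card K ^ 2))
    fun v hv => natCard_pairDisc_ne_zero v.1 fun hv0 => Finset.ne_of_mem_erase hv (Subtype.ext hv0)]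
  rw [hzero, Finset.sum_const, Finset.card_erase_of_mem (Finset.mem_univ _), Finset.card_univ,
    ← Nat.card_eq_fintype_card, hlin, nsmul_eq_mul,
    Nat.cast_sub (Nat.one_le_pow _ _ Nat.card_pos)]
  push_cast
  ring

end Counting

/-! ### Reduction of the incidence condition by a kernel vector. -/

section Coefficients

variable {K : Type*} [Field K]

/-- The discriminant of the ternary quadratic form with coefficient vector
`(a₀₀, a₀₁, a₀₂, a₁₁, a₁₂, a₂₂)`. -/
def coeffDisc (a : Fin 6 → K) : K :=
  4 * a 0 * a 3 * a 5 + a 1 * a 2 * a 4 - a 0 * a 4 ^ 2 - a 3 * a 2 ^ 2 - a 5 * a 1 ^ 2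

/-- The coefficient vectors of the non-singular conics whose hyperplane contains `y`. -/
def nonsingularCoeffs (y : Fin 6 → K) : Set (Fin 6 → K) :=
  {a | coeffDisc a ≠ 0 ∧ a ⬝ᵥ y = 0}

theorem dotProduct_fin_six (a y : Fin 6 → K) :
    a ⬝ᵥ y = a 0 * y 0 + a 1 * y 1 + a 2 * y 2 + a 3 * y 3 + a 4 * y 4 + a 5 * y 5 := by
  simp [dotProduct, Fin.sum_univ_succ, add_assoc]

theorem fin_six_ext {α : Type*} {a b : Fin 6 → α} (h0 : a 0 = b 0) (h1 : a 1 = b 1) (h2 : a 2 = b 2)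
    (h3 : a 3 = b 3) (h4 : a 4 = b 4) (h5 : a 5 = b 5) : a = b := by
  funext i
  fin_cases i <;> assumption

/-- The effect of the substitution `X₂ ↦ X₂ - u X₀ - v X₁` on coefficient vectors. -/
def shearCoeffs (u v : K) (a : Fin 6 → K) : Fin 6 → K :=
  ![a 0 - u * a 2 + u ^ 2 * a 5, a 1 - u * a 4 - v * a 2 + 2 * u * v * a 5, a 2 - 2 * u * a 5,
    a 3 - v * a 4 + v ^ 2 * a 5, a 4 - 2 * v * a 5, a 5]

theorem shearCoeffs_neg (u v : K) (a : Fin 6 → K) :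
    shearCoeffs (-u) (-v) (shearCoeffs u v a) = a := by
  apply fin_six_ext <;> simp [shearCoeffs] <;> ring

theorem coeffDisc_shearCoeffs (u v : K) (a : Fin 6 → K) :
    coeffDisc (shearCoeffs u v a) = coeffDisc a := by
  simp [shearCoeffs, coeffDisc]; ring

/-- The coefficient vector after the shear by `(u, v)`, grouped as for `pairDisc`. -/
def shearEquiv (u v : K) : (Fin 6 → K) ≃ (K × K × K) × (K × K × K) where
  toFun a := ((shearCoeffs u v a 0, shearCoeffs u v a 1, shearCoeffs u v a 3),
    (shearCoeffs u v a 2, shearCoeffs u v a 4, shearCoeffs u v a 5))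
  invFun p := shearCoeffs (-u) (-v) ![p.1.1, p.1.2.1, p.2.1, p.1.2.2, p.2.2.1, p.2.2.2]
  left_inv a := by
    conv_rhs => rw [← shearCoeffs_neg u v a]
    congr 1
  right_inv p := by
    have h := shearCoeffs_neg (-u) (-v) ![p.1.1, p.1.2.1, p.2.1, p.1.2.2, p.2.2.1, p.2.2.2]
    rw [neg_neg, neg_neg] at h
    simp only [h]
    rfl

/-- The hypotheses say that `(u, v, 1)` is in the kernel of the matrix of `y`. Eliminating `y 2`, `y
4`, `y 5` from `a ⬝ᵥ y` leaves exactly the sheared coefficients at `0, 1, 3`, paired with `y 0`, `y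
1`, `y 3`; these are not all zero, as they determine `y`. -/
theorem ncard_nonsingularCoeffs_of_kernel [Finite K] (y : Fin 6 → K) (hy : y ≠ 0) (u v : K)
    (h2 : y 2 = -(u * y 0 + v * y 1)) (h4 : y 4 = -(u * y 1 + v * y 3))
    (h5 : y 5 = -(u * y 2 + v * y 4)) :
    ((nonsingularCoeffs y).ncard : ℤ)
      = ((Nat.card K : ℤ) ^ 2 - 1) * (Nat.card K ^ 3 - Nat.card K ^ 2) := by
  have hne : ¬(y 0 = 0 ∧ y 1 = 0 ∧ y 3 = 0) := by
    rintro ⟨e0, e1, e3⟩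
    rw [e0, e1] at h2
    rw [e1, e3] at h4
    rw [h2, h4] at h5
    apply hy
    apply fin_six_ext <;> simp [*]
  rw [← natCard_pairs _ _ _ hne, ← Nat.card_coe_set_eq]
  congr 1
  refine Nat.card_congr (Equiv.subtypeEquiv (shearEquiv u v) fun a => ?_)
  refine and_congr ?_ ?_
  · rw [← coeffDisc_shearCoeffs u v a]
    exact Iff.rfl
  · rw [dotProduct_fin_six, h5, h4, h2]
    simp only [shearEquiv, shearCoeffs, Equiv.coe_fn_mk]
    constructor <;> intro e
    · rw [← e]; simp; ring
    · rw [← e]; simp; ring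

theorem ncard_nonsingularCoeffs_permute [Finite K] (e : Equiv.Perm (Fin 6))
    (he : ∀ a : Fin 6 → K, coeffDisc (a ∘ e) = coeffDisc a) (y : Fin 6 → K) :
    (nonsingularCoeffs (y ∘ e)).ncard = (nonsingularCoeffs y).ncard := by
  rw [← Nat.card_coe_set_eq, ← Nat.card_coe_set_eq]
  refine (Nat.card_congr (Equiv.subtypeEquiv (e.arrowCongr (Equiv.refl K)).symm fun a => ?_)).symm
  change _ ↔ coeffDisc (a ∘ e) ≠ 0 ∧ (a ∘ e) ⬝ᵥ (y ∘ e) = 0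
  rw [he, comp_equiv_dotProduct_comp_equiv]
  exact Iff.rfl

theorem ncard_nonsingularCoeffs [Finite K] (y : Fin 6 → K) (hy : y ≠ 0)
    (hdet : (symMatrix y).det = 0) :
    ((nonsingularCoeffs y).ncard : ℤ)
      = ((Nat.card K : ℤ) ^ 2 - 1) * (Nat.card K ^ 3 - Nat.card K ^ 2) := by
  obtain ⟨w, hw, hm⟩ := Matrix.exists_mulVec_eq_zero_iff.2 hdet
  have m0 : y 0 * w 0 + y 1 * w 1 + y 2 * w 2 = 0 := by
    simpa [symMatrix, Matrix.mulVec, dotProduct, Fin.sum_univ_succ, add_assoc] using congrFun hm 0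
  have m1 : y 1 * w 0 + y 3 * w 1 + y 4 * w 2 = 0 := by
    simpa [symMatrix, Matrix.mulVec, dotProduct, Fin.sum_univ_succ, add_assoc] using congrFun hm 1
  have m2 : y 2 * w 0 + y 4 * w 1 + y 5 * w 2 = 0 := by
    simpa [symMatrix, Matrix.mulVec, dotProduct, Fin.sum_univ_succ, add_assoc] using congrFun hm 2
  have hcomp : ∀ e : Equiv.Perm (Fin 6), y ∘ e ≠ 0 := fun e h0 => hy <| by
    funext i
    simpa using congrFun h0 (e.symm i)
  by_cases w2 : w 2 = 0
  · by_cases w1 : w 1 = 0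
    · have w0 : w 0 ≠ 0 := fun w0 => hw <| by
        funext i
        fin_cases i <;> assumption
      rw [w1, w2] at m0 m1 m2
      -- Induced by exchanging `X₀` and `X₂`; the kernel vector becomes a multiple of `(0, 0, 1)`.
      let e : Equiv.Perm (Fin 6) := Equiv.swap 0 5 * Equiv.swap 1 4
      have E : y ∘ e = ![y 5, y 4, y 2, y 3, y 1, y 0] := by
        apply fin_six_ext <;> rfl
      rw [← ncard_nonsingularCoeffs_permute e
        (fun a => by
          have E : a ∘ e = ![a 5, a 4, a 2, a 3, a 1, a 0] := by
            apply fin_six_ext <;> rfl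
          rw [E]; simp [coeffDisc]; ring) y]
      refine ncard_nonsingularCoeffs_of_kernel _ (hcomp e) 0 0 ?_ ?_ ?_ <;>
        rw [E] <;> simp_all
    · rw [w2] at m0 m1 m2
      -- Induced by exchanging `X₁` and `X₂`; the kernel vector becomes `(w 0, 0, w 1)`.
      let e : Equiv.Perm (Fin 6) := Equiv.swap 1 2 * Equiv.swap 3 5
      have E : y ∘ e = ![y 0, y 2, y 1, y 5, y 4, y 3] := by
        apply fin_six_ext <;> rfl
      rw [← ncard_nonsingularCoeffs_permute e
        (fun a => by
          have E : a ∘ e = ![a 0, a 2, a 1, a 5, a 4, a 3] := by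
            apply fin_six_ext <;> rfl
          rw [E]; simp [coeffDisc]; ring) y]
      refine ncard_nonsingularCoeffs_of_kernel _ (hcomp e) (w 0 / w 1) 0 ?_ ?_ ?_ <;>
        rw [E] <;> simp <;> field_simp
      · linear_combination m0
      · linear_combination m2
      · linear_combination m1
  · refine ncard_nonsingularCoeffs_of_kernel _ hy (w 0 / w 2) (w 1 / w 2) ?_ ?_ ?_ <;> field_simp
    · linear_combination m0
    · linear_combination m1
    · linear_combination m2

end Coefficients

/-! ### From coefficient vectors to hyperplanes. -/

section Hyperplanes

variable {K : Type*} [Field K]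

/-- The hyperplane with coefficient vector `a`. -/
noncomputable def coeffHyperplane (a : Fin 6 → K) : Submodule K (Fin 6 → K) :=
  LinearMap.ker (Fintype.linearCombination K a)

theorem mem_coeffHyperplane {a y : Fin 6 → K} : y ∈ coeffHyperplane a ↔ a ⬝ᵥ y = 0 := by
  simp [coeffHyperplane, Fintype.linearCombination_apply, dotProduct, mul_comm]

theorem isCoatom_coeffHyperplane {a : Fin 6 → K} (ha : a ≠ 0) : IsCoatom (coeffHyperplane a) := by
  refine LinearMap.isCoatom_ker_of_surjective (LinearMap.surjective ?_)
  intro h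
  apply ha
  funext i
  simpa [Fintype.linearCombination_apply_single] using LinearMap.congr_fun h (Pi.single i 1)

theorem coeffHyperplane_eq_iff {a b : Fin 6 → K} (hb : b ≠ 0) :
    coeffHyperplane b = coeffHyperplane a ↔ ∃ c : Kˣ, c • a = b := by
  constructor
  · intro h
    have hle : ⨅ _ : Unit, LinearMap.ker (Fintype.linearCombination K a) ≤
        LinearMap.ker (Fintype.linearCombination K b) := by
      rw [iInf_const]; exact h.ge
    have := mem_span_of_iInf_ker_le_ker hle
    rw [Set.range_const, Submodule.mem_span_singleton] at this
    obtain ⟨c, hc⟩ := this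
    have hcab : c • a = b := by
      funext i
      simpa [Fintype.linearCombination_apply_single] using LinearMap.congr_fun hc (Pi.single i 1)
    have hc0 : c ≠ 0 := by
      rintro rfl
      exact hb (by simpa using hcab.symm)
    exact ⟨Units.mk0 c hc0, hcab⟩
  · rintro ⟨c, rfl⟩
    ext y
    rw [mem_coeffHyperplane, mem_coeffHyperplane, smul_dotProduct]
    exact smul_eq_zero_iff_eq c

theorem coeffDisc_smul (c : K) (a : Fin 6 → K) : coeffDisc (c • a) = c ^ 3 * coeffDisc a := by
  simp [coeffDisc]; ring

theorem ne_zero_of_coeffDisc_ne_zero {a : Fin 6 → K} (ha : coeffDisc a ≠ 0) : a ≠ 0 := by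
  rintro rfl
  exact ha (by simp [coeffDisc])

/-- The quadratic form with coefficient vector `a`. -/
noncomputable def coeffForm (a : Fin 6 → K) : MvPolynomial (Fin 3) K :=
  MvPolynomial.monomial (Finsupp.single 0 1 + Finsupp.single 0 1) (a 0)
    + MvPolynomial.monomial (Finsupp.single 0 1 + Finsupp.single 1 1) (a 1)
    + MvPolynomial.monomial (Finsupp.single 0 1 + Finsupp.single 2 1) (a 2)
    + MvPolynomial.monomial (Finsupp.single 1 1 + Finsupp.single 1 1) (a 3)
    + MvPolynomial.monomial (Finsupp.single 1 1 + Finsupp.single 2 1) (a 4)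
    + MvPolynomial.monomial (Finsupp.single 2 1 + Finsupp.single 2 1) (a 5)

/-- The coefficient vector of a ternary quadratic form. -/
noncomputable def formCoeffs (f : MvPolynomial (Fin 3) K) : Fin 6 → K :=
  ![quadCoeff f 0 0, quadCoeff f 0 1, quadCoeff f 0 2,
    quadCoeff f 1 1, quadCoeff f 1 2, quadCoeff f 2 2]

theorem isHomogeneous_coeffForm (a : Fin 6 → K) : (coeffForm a).IsHomogeneous 2 := by
  refine .add (.add (.add (.add (.add ?_ ?_) ?_) ?_) ?_) ?_ <;>
    exact MvPolynomial.isHomogeneous_monomial _ (by simp)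

theorem formCoeffs_coeffForm (a : Fin 6 → K) : formCoeffs (coeffForm a) = a := by
  apply fin_six_ext <;>
    simp [formCoeffs, coeffForm, quadCoeff, MvPolynomial.coeff_monomial, Finsupp.ext_iff,
      Fin.forall_fin_succ, Finsupp.single_apply]

theorem typeH3_through_eq_image (P : ℙ K (Fin 6 → K)) :
    {H ∈ typeH3 K | P.submodule ≤ H} = coeffHyperplane '' nonsingularCoeffs P.rep := by
  have hmem : ∀ a : Fin 6 → K, P.submodule ≤ coeffHyperplane a ↔ a ⬝ᵥ P.rep = 0 := by
    intro a
    rw [P.submodule_eq, Submodule.span_singleton_le_iff_mem, mem_coeffHyperplane]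
  ext H
  constructor
  · rintro ⟨⟨-, f, -, hd, rfl⟩, hP⟩
    exact ⟨formCoeffs f, ⟨hd, (hmem (formCoeffs f)).1 hP⟩, rfl⟩
  · rintro ⟨a, ⟨hd, ha⟩, rfl⟩
    refine ⟨⟨isCoatom_coeffHyperplane (ne_zero_of_coeffDisc_ne_zero hd), coeffForm a,
      isHomogeneous_coeffForm a, ?_, ?_⟩, (hmem a).2 ha⟩
    · change coeffDisc (formCoeffs (coeffForm a)) ≠ 0
      rwa [formCoeffs_coeffForm]
    · change _ = coeffHyperplane (formCoeffs (coeffForm a))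
      rw [formCoeffs_coeffForm]

/-- The fibres of `coeffHyperplane` are orbits of `Kˣ`, which acts freely on nonzero vectors and
preserves both defining conditions. -/
theorem ncard_nonsingularCoeffs_eq_mul [Finite K] (y : Fin 6 → K) :
    (nonsingularCoeffs y).ncard
      = (coeffHyperplane '' nonsingularCoeffs y).ncard * Nat.card Kˣ := by
  classical
  have := Fintype.ofFinite K
  have hfin := (nonsingularCoeffs y).toFinite
  rw [Set.ncard_eq_toFinset_card _ hfin, Set.ncard_eq_toFinset_card _ (hfin.image _),
    Set.Finite.toFinset_image _ hfin, Finset.card_eq_sum_card_image coeffHyperplane,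
    Finset.sum_const_nat]
  intro H hH
  obtain ⟨a, ha, rfl⟩ := Finset.mem_image.1 hH
  rw [Set.Finite.mem_toFinset] at ha
  have ha0 := ne_zero_of_coeffDisc_ne_zero ha.1
  have hfib : {b ∈ hfin.toFinset | coeffHyperplane b = coeffHyperplane a}
      = Finset.univ.image fun c : Kˣ => c • a := by
    ext b
    simp only [Finset.mem_filter, Set.Finite.mem_toFinset, Finset.mem_image, Finset.mem_univ,
      true_and]
    constructor
    · rintro ⟨hb, h⟩
      exact (coeffHyperplane_eq_iff (ne_zero_of_coeffDisc_ne_zero hb.1)).1 h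
    · rintro ⟨c, rfl⟩
      have hd : coeffDisc (c • a) ≠ 0 := by
        rw [Units.smul_def, coeffDisc_smul]
        exact mul_ne_zero (pow_ne_zero _ c.ne_zero) ha.1
      refine ⟨⟨hd, ?_⟩,
        (coeffHyperplane_eq_iff (ne_zero_of_coeffDisc_ne_zero hd)).2 ⟨c, rfl⟩⟩
      rw [smul_dotProduct, ha.2, smul_zero]
  rw [hfib, Finset.card_image_of_injective, Finset.card_univ, Nat.card_eq_fintype_card]
  intro c d hcd
  obtain ⟨i, hi⟩ := Function.ne_iff.1 ha0
  exact Units.ext (mul_right_cancel₀ hi (congrFun hcd i))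

theorem ncard_typeH3_through [Finite K] (P : ℙ K (Fin 6 → K))
    (hdet : (symMatrix P.rep).det = 0) :
    ({H ∈ typeH3 K | P.submodule ≤ H}.ncard : ℤ) = (Nat.card K : ℤ) ^ 4 - (Nat.card K : ℤ) ^ 2 := by
  have h1 := ncard_nonsingularCoeffs P.rep P.rep_nonzero hdet
  have hq : 1 < Nat.card K := Finite.one_lt_card
  rw [ncard_nonsingularCoeffs_eq_mul, ← typeH3_through_eq_image, Nat.card_units] at h1
  push_cast [hq.le] at h1
  have hne : (Nat.card K : ℤ) - 1 ≠ 0 := by omega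
  -- `(q² - 1)(q³ - q²) = (q⁴ - q²)(q - 1)`.
  apply mul_right_cancel₀ hne
  linear_combination h1

end Hyperplanes

/-! ### Vanishing of the determinant. -/

section SecantVariety

/-- The determinant of the generic symmetric `3 × 3` matrix. -/
noncomputable def symDet (F : Type*) [Field F] : MvPolynomial (Fin 6) F :=
  open MvPolynomial in
  X 0 * X 3 * X 5 + X 1 * X 2 * X 4 + X 1 * X 2 * X 4 - X 0 * X 4 * X 4 - X 3 * X 2 * X 2
    - X 5 * X 1 * X 1

theorem isHomogeneous_symDet (F : Type*) [Field F] : (symDet F).IsHomogeneous 3 := by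
  have h (i j k : Fin 6) :
      (MvPolynomial.X i * MvPolynomial.X j * MvPolynomial.X k :
        MvPolynomial (Fin 6) F).IsHomogeneous 3 :=
    ((MvPolynomial.isHomogeneous_X F i).mul (MvPolynomial.isHomogeneous_X F j)).mul
      (MvPolynomial.isHomogeneous_X F k)
  exact ((((((h _ _ _).add (h _ _ _)).add (h _ _ _)).sub (h _ _ _)).sub (h _ _ _)).sub (h _ _ _))

/-- On a secant line the matrix is `s uuᵀ + t vvᵀ`, of rank at most 2, so the determinant is a cubic
form to which the definition of the closure applies. -/
theorem det_symMatrix_eq_zero_of_mem_secantVariety {K : Type*} [Field K] {P : ℙ K (Fin 6 → K)}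
    (hP : P ∈ secantVariety K) : (symMatrix P.rep).det = 0 := by
  have h := hP 3 (symDet _) (isHomogeneous_symDet _) fun u v _ s t => by
    simp [symDet, veronese]
    ring
  apply (algebraMap K (AlgebraicClosure K)).injective
  rw [map_zero, ← h, Matrix.det_fin_three]
  simp [symDet, symMatrix]
  ring

theorem det_symMatrix_eq_zero_of_pointRank_le {K : Type*} [Field K] {P : ℙ K (Fin 6 → K)}
    (hP : pointRank P ≤ 2) : (symMatrix P.rep).det = 0 := by
  by_contra h
  have := Matrix.rank_of_det_ne_zero h
  rw [Fintype.card_fin] at this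
  unfold pointRank at hP
  omega

end SecantVariety

end ConicSystems

theorem mainTheorem4 (K : Type*) [Field K] [Fintype K] (q : ℕ) (hq : Fintype.card K = q) :
    (∀ P : ℙ K (Fin 6 → K), P ∈ ConicSystems.secantVariety K →
      (({H ∈ ConicSystems.typeH3 K | P.submodule ≤ H}.ncard : ℕ) : ℤ)
        = (q : ℤ) ^ 4 - (q : ℤ) ^ 2) ∧
    (∀ P : ℙ K (Fin 6 → K), ConicSystems.pointRank P ≤ 2 →
      (({H ∈ ConicSystems.typeH3 K | P.submodule ≤ H}.ncard : ℕ) : ℤ)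
        = (q : ℤ) ^ 4 - (q : ℤ) ^ 2) := by
  rw [← hq, ← Nat.card_eq_fintype_card]
  exact ⟨fun P hP => ConicSystems.ncard_typeH3_through P
      (ConicSystems.det_symMatrix_eq_zero_of_mem_secantVariety hP),
    fun P hP => ConicSystems.ncard_typeH3_through P
      (ConicSystems.det_symMatrix_eq_zero_of_pointRank_le hP)⟩
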